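/- For a positive integer $r$ put $$\mathcal K_r=\left\{\tfrac{r^2+1}{2},\ \tfrac{r^2-1}{2},\ \tfrac{(r^2+1)^2}{2r(r+1)},\ \tfrac{(r-1)(r^2+1)}{4r},\ \tfrac{r^2+1}{2r};\ 1,\ \tfrac{(r-1)(r^2+1)}{2r(r+1)},\ \tfrac{(r+1)(r^2+1)}{4r},\ \tfrac{(r-1)(r^2+1)}{2r},\ \tfrac{r^2+1}{2}\right\}.$$ Let $(X,\{R_i\}_{i=0}^5)$ denote a symmetric association scheme with $5$ classes, with adjacency matrices $A_i$ and intersection numbers $p_{ij}^k$. For an ordering $E_0=\frac1{|X|}J,E_1,\dots,E_5$ of its primitive idempotents, the second eigenmatrix $Q$ is given by $E_i=\frac1{|X|}\sum_j Q_{ji}A_j$, and the Krein parameters $q_{ij}^k$ by $E_i\circ E_j=\frac1{|X|}\sum_k q_{ij}^kE_k$, where $\circ$ is the entrywise product. The ordering is $Q$-polynomial if for each $i$ there is a polynomial $v_i^*$ of degree $i$ with $Q_{ji}=v_i^*(Q_{j1})$ for all $j$; its Krein array is $\{b_0^*,\dots,b_4^*;c_1^*,\dots,c_5^*\}$ with $b_i^*=q_{1,i+1}^i$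 and $c_i^*=q_{1,i-1}^i$. The scheme is $Q$-polynomial with Krein array $\mathcal K$ if it has a $Q$-polynomial ordering with Krein array $\mathcal K$. **Theorem.** 1. If $r\equiv 3\pmod 4$, there is no $Q$-polynomial association scheme with Krein array $\mathcal K_r$. 2. Let $r\ge 3$ be odd, let $(X,\{R_i\}_{i=0}^5)$ be a $Q$-polynomial association scheme with Krein array $\mathcal K_r$ (with respect to the ordering $E_0,\dots,E_5$), and let the relations be in their natural ordering, that is, $Q_{01}>Q_{11}>\dots>Q_{51}$. Let $x,y,z\in X$ be mutually in relation $R_1$, and let $[i\ j\ k]$ be the number of $w\in X$ with $(x,w)\in R_i$, $(y,w)\in R_j$, $(z,w)\in R_k$. Consider the following system in unknown real numbers $T_{ijk}\ge 0$ $(0\le i,j,k\le 5)$: for all $i,j,k$, $$\sum_{\ell}T_{\ell jk}=p^1_{jk},\qquad \sum_{\ell}T_{i\ell k}=p^1_{ik},\qquad \sum_{\ell}T_{ij\ell}=p^1_{ij},$$ $$T_{0jk}=\delta_{j1}\delta_{k1},\qquad T_{i0k}=\delta_{i1}\delta_{k1},\qquad T_{ij0}=\delta_{i1}\delta_{j1},$$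 and, for all $a,b,c$ with $q_{ab}^c=0$, $\ \sum_{i,j,k}Q_{ia}Q_{jb}Q_{kc}T_{ijk}=0$. Then $T_{ijk}=[i\ j\ k]$ is the unique solution of this system, and $$[1\ 1\ 1]=\frac{r-5}{4}.$$ 3. For every positive integer $r$, the number $\frac{r-5}{4}$ is an integer if and only if $r\equiv 1\pmod 4$. -/

import Mathlib

/-- A symmetric association scheme with `D` classes on a finite set `X`.  The partition
`R_0, …, R_D` of `X × X` is given by the map `rel`, so `(x, y) ∈ R_i` means `rel x y = i`.
All relations are nonempty, `R_0` is the identity relation, all relations are symmetric, and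
`p i j k` are the intersection numbers `p_{ij}^k`. -/
structure AssociationScheme (X : Type*) [Fintype X] (D : ℕ) where
  rel : X → X → Fin (D + 1)
  p : Fin (D + 1) → Fin (D + 1) → Fin (D + 1) → ℕ
  rel_nonempty : ∀ i, ∃ x y, rel x y = i
  rel_eq_zero_iff : ∀ x y, rel x y = 0 ↔ x = y
  rel_symm : ∀ x y, rel x y = rel y x
  card_eq_p : ∀ i j k x y, rel x y = k →
    (Finset.univ.filter fun z => rel x z = i ∧ rel y z = j).card = p i j k

namespace AssociationScheme

variable {X : Type*} [Fintype X] {D : ℕ}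

/-- The adjacency matrix `A_i` of the graph `(X, R_i)`. -/
def adj (S : AssociationScheme X D) (i : Fin (D + 1)) : Matrix X X ℝ :=
  Matrix.of fun x y => if S.rel x y = i then 1 else 0

/-- The triple intersection number `[i j k]` with respect to the vertices `x, y, z`. -/
def triple (S : AssociationScheme X D) (x y z : X) (i j k : Fin (D + 1)) : ℕ :=
  (Finset.univ.filter fun w => S.rel x w = i ∧ S.rel y w = j ∧ S.rel z w = k).card

/-- `E_0, …, E_D` is an ordering, with `E_0 = |X|⁻¹ J`, of the primitive idempotents of the
algebra spanned by `A_0, …, A_D`.  This algebra has dimension `D + 1`, so `D + 1` nonzero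
pairwise orthogonal idempotents in it form a basis and are precisely the primitive ones. -/
structure IsIdempotentOrdering [DecidableEq X] (S : AssociationScheme X D)
    (E : Fin (D + 1) → Matrix X X ℝ) : Prop where
  mem_span : ∀ i, E i ∈ Submodule.span ℝ (Set.range S.adj)
  ne_zero : ∀ i, E i ≠ 0
  idem : ∀ i, E i * E i = E i
  orthogonal : ∀ i j, i ≠ j → E i * E j = 0
  sum_eq_one : ∑ i, E i = 1
  zero_eq : E 0 = Matrix.of fun _ _ => (Fintype.card X : ℝ)⁻¹

/-- `Q` is the second eigenmatrix: `E_i = |X|⁻¹ ∑_j Q_{ji} A_j`. -/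
def IsSecondEigenmatrix (S : AssociationScheme X D) (E : Fin (D + 1) → Matrix X X ℝ)
    (Q : Matrix (Fin (D + 1)) (Fin (D + 1)) ℝ) : Prop :=
  ∀ i, E i = (Fintype.card X : ℝ)⁻¹ • ∑ j, Q j i • S.adj j

/-- `q i j k` are the Krein parameters `q_{ij}^k`:
`E_i ∘ E_j = |X|⁻¹ ∑_k q_{ij}^k E_k`, where `∘` is the entrywise product. -/
def IsKreinParameters (E : Fin (D + 1) → Matrix X X ℝ)
    (q : Fin (D + 1) → Fin (D + 1) → Fin (D + 1) → ℝ) : Prop :=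
  ∀ i j, Matrix.hadamard (E i) (E j) = (Fintype.card X : ℝ)⁻¹ • ∑ k, q i j k • E k

/-- The ordering of the idempotents with second eigenmatrix `Q` is `Q`-polynomial: column `i`
of `Q` is a polynomial of degree `i` in column `1`. -/
def IsQPolynomial (Q : Matrix (Fin (D + 1)) (Fin (D + 1)) ℝ) : Prop :=
  ∀ i : Fin (D + 1), ∃ v : Polynomial ℝ,
    v.degree = (i : ℕ) ∧ ∀ j, Q j i = v.eval (Q j 1)

/-- `E` is a `Q`-polynomial ordering of the primitive idempotents of `S`, with second
eigenmatrix `Q`, Krein parameters `q`, and Krein array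
`{b 0, b 1, …, b (D - 1); c 0, c 1, …, c (D - 1)}`.  In the usual notation `b i` is
`b_i^* = q_{1,i+1}^i`, and `c i` is `c_{i+1}^* = q_{1,i}^{i+1}`. -/
structure IsQPolynomialWithKreinArray [DecidableEq X] (S : AssociationScheme X D)
    (E : Fin (D + 1) → Matrix X X ℝ) (Q : Matrix (Fin (D + 1)) (Fin (D + 1)) ℝ)
    (q : Fin (D + 1) → Fin (D + 1) → Fin (D + 1) → ℝ) (b c : Fin D → ℝ) : Prop where
  idempotents : S.IsIdempotentOrdering E
  eigenmatrix : S.IsSecondEigenmatrix E Q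
  krein : IsKreinParameters E q
  qPolynomial : IsQPolynomial Q
  b_eq : ∀ i : Fin D, q 1 i.succ i.castSucc = b i
  c_eq : ∀ i : Fin D, q 1 i.castSucc i.succ = c i

/-- `S` is a `Q`-polynomial scheme with the given Krein array. -/
def HasKreinArray [DecidableEq X] (S : AssociationScheme X D) (b c : Fin D → ℝ) : Prop :=
  ∃ E Q q, S.IsQPolynomialWithKreinArray E Q q b c

/-- The natural ordering of the relations: the first column of `Q` is decreasing. -/
def IsNaturalOrdering (Q : Matrix (Fin (D + 1)) (Fin (D + 1)) ℝ) : Prop :=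
  StrictAnti fun i => Q i 1

/-- `T i j k` is a nonnegative real solution of the system of linear equations for the triple
intersection numbers `[i j k]` with respect to vertices `x, y, z` such that
`(x, y) ∈ R_r`, `(x, z) ∈ R_s`, `(y, z) ∈ R_t`: the equations that relate them to the
intersection numbers, the known values when one index is `0`, and one equation for each
vanishing Krein parameter. -/
structure IsTripleSolution (S : AssociationScheme X D)
    (Q : Matrix (Fin (D + 1)) (Fin (D + 1)) ℝ)
    (q : Fin (D + 1) → Fin (D + 1) → Fin (D + 1) → ℝ) (r s t : Fin (D + 1))
    (T : Fin (D + 1) → Fin (D + 1) → Fin (D + 1) → ℝ) : Prop where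
  nonneg : ∀ i j k, 0 ≤ T i j k
  sum_fst : ∀ j k, ∑ l, T l j k = S.p j k t
  sum_snd : ∀ i k, ∑ l, T i l k = S.p i k s
  sum_trd : ∀ i j, ∑ l, T i j l = S.p i j r
  zero_fst : ∀ j k, T 0 j k = if j = r ∧ k = s then 1 else 0
  zero_snd : ∀ i k, T i 0 k = if i = r ∧ k = t then 1 else 0
  zero_trd : ∀ i j, T i j 0 = if i = s ∧ j = t then 1 else 0
  krein : ∀ a b c, q a b c = 0 → ∑ i, ∑ j, ∑ k, Q i a * Q j b * Q k c * T i j k = 0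

end AssociationScheme

/-- The parameters `b_0^*, …, b_4^*` of the Krein array of the family. -/
noncomputable def familyB (r : ℝ) : Fin 5 → ℝ :=
  ![(r ^ 2 + 1) / 2, (r ^ 2 - 1) / 2, (r ^ 2 + 1) ^ 2 / (2 * r * (r + 1)),
    (r - 1) * (r ^ 2 + 1) / (4 * r), (r ^ 2 + 1) / (2 * r)]

/-- The parameters `c_1^*, …, c_5^*` of the Krein array of the family. -/
noncomputable def familyC (r : ℝ) : Fin 5 → ℝ :=
  ![1, (r - 1) * (r ^ 2 + 1) / (2 * r * (r + 1)), (r + 1) * (r ^ 2 + 1) / (4 * r),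
    (r - 1) * (r ^ 2 + 1) / (2 * r), (r ^ 2 + 1) / 2]

/-! The array satisfies b_i^* + c_i^* = b_0^* (with c_0^* = 0 and b_5^* = 0), so every a_i^*
vanishes and each row of Q obeys a three-term recursion determined by its entry in column 1. That
entry is a root of a sextic with roots ±(r^2+1)/2, ±(r^2+1)/(2√r), ±(r^2+1)/(2r), so the natural
ordering forces Q to be `familyQ` with s = √r, and p_{ij}^1 to be `familyP` (`eq_familyQ`,
`p_one_eq_familyP`).

Reversing the relations multiplies column a of Q by (-1)^a. Hence q_{ad}^e = 0 for odd a+d+e, and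
every solution T is invariant under reversal (`tripleSolution_rev`). Zeros of p_{ij}^1 together with
nonnegativity then kill most entries, the sum equations leave T_{112} as the only parameter, and
q_{11}^4 = 0 forces it to vanish (`tripleSolution_eq`). The triple intersection numbers are a
solution (`isTripleSolution`), so they are the only one, and [1 1 1] = (r-5)/4.

Since p_{11}^1 = (r-1)/2 > 0, a triangle in R_1 exists. For r ≡ 3 (mod 4) the count (r-5)/4 would
not be an integer, so no scheme exists. -/

namespace AssociationScheme

/-! ### Idempotent identities, triple intersection numbers and vanishing Krein parameters. -/

section General

variable {X : Type*} [Fintype X] {D : ℕ} (S : AssociationScheme X D)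

lemma card_pos (S : AssociationScheme X D) : 0 < (Fintype.card X : ℝ) := by
  obtain ⟨x, -, -⟩ := S.rel_nonempty 0
  exact_mod_cast Fintype.card_pos_iff.2 ⟨x⟩

lemma rel_self (x : X) : S.rel x x = 0 := (S.rel_eq_zero_iff x x).2 rfl

/-- Summing a function of the relations of `w` to `x` and `y` over all `w`. -/
lemma sum_comp_rel (F : Fin (D + 1) → Fin (D + 1) → ℝ) (x y : X) :
    ∑ w, F (S.rel x w) (S.rel y w) = ∑ i, ∑ j, F i j * S.p i j (S.rel x y) := by
  have h : ∀ i j, F i j * S.p i j (S.rel x y) =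
      ∑ w, if S.rel x w = i ∧ S.rel y w = j then F i j else 0 := by
    intro i j
    rw [← S.card_eq_p i j _ x y rfl, ← Finset.sum_filter, Finset.sum_const, nsmul_eq_mul, mul_comm]
  simp_rw [h, ite_and]
  rw [Finset.sum_congr rfl fun i _ => Finset.sum_comm, Finset.sum_comm]
  simp

/-- Summing a function of the relations of `w` to `x`, `y` and `z` over all `w`. -/
lemma sum_comp_rel_triple (F : Fin (D + 1) → Fin (D + 1) → Fin (D + 1) → ℝ) (x y z : X) :
    ∑ w, F (S.rel x w) (S.rel y w) (S.rel z w) =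
      ∑ i, ∑ j, ∑ k, F i j k * S.triple x y z i j k := by
  have h : ∀ i j k, F i j k * S.triple x y z i j k =
      ∑ w, if S.rel x w = i ∧ S.rel y w = j ∧ S.rel z w = k then F i j k else 0 := by
    intro i j k
    rw [triple, ← Finset.sum_filter, Finset.sum_const, nsmul_eq_mul, mul_comm]
  simp_rw [h, ite_and]
  rw [Finset.sum_congr rfl fun i _ => Finset.sum_congr rfl fun j _ => Finset.sum_comm,
    Finset.sum_congr rfl fun i _ => Finset.sum_comm, Finset.sum_comm]
  simp

lemma sum_triple_fst (x y z : X) (j k : Fin (D + 1)) :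
    ∑ l, (S.triple x y z l j k : ℝ) = S.p j k (S.rel y z) := by
  rw [← S.card_eq_p j k _ y z rfl,
    Finset.card_eq_sum_card_fiberwise (f := S.rel x) (t := Finset.univ) (by simp)]
  push_cast
  refine Finset.sum_congr rfl fun l _ => ?_
  simp only [triple, Finset.filter_filter]
  congr 2
  ext w
  simp
  tauto

lemma sum_triple_snd (x y z : X) (i k : Fin (D + 1)) :
    ∑ l, (S.triple x y z i l k : ℝ) = S.p i k (S.rel x z) := by
  rw [← S.card_eq_p i k _ x z rfl,
    Finset.card_eq_sum_card_fiberwise (f := S.rel y) (t := Finset.univ) (by simp)]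
  push_cast
  refine Finset.sum_congr rfl fun l _ => ?_
  simp only [triple, Finset.filter_filter]
  congr 2
  ext w
  simp
  tauto

lemma sum_triple_trd (x y z : X) (i j : Fin (D + 1)) :
    ∑ l, (S.triple x y z i j l : ℝ) = S.p i j (S.rel x y) := by
  rw [← S.card_eq_p i j _ x y rfl,
    Finset.card_eq_sum_card_fiberwise (f := S.rel z) (t := Finset.univ) (by simp)]
  push_cast
  refine Finset.sum_congr rfl fun l _ => ?_
  simp only [triple, Finset.filter_filter]
  congr 2
  ext w
  simp
  tauto

lemma triple_zero_fst (x y z : X) (j k : Fin (D + 1)) :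
    S.triple x y z 0 j k = if j = S.rel x y ∧ k = S.rel x z then 1 else 0 := by
  classical
  simp only [triple, S.rel_eq_zero_iff, Finset.filter_and, Finset.filter_eq, Finset.mem_univ,
    if_true, S.rel_symm x y, S.rel_symm x z]
  split_ifs with h
  · rw [Finset.card_eq_one]
    refine ⟨x, ?_⟩
    ext w
    simp only [Finset.mem_inter, Finset.mem_singleton, Finset.mem_filter, Finset.mem_univ]
    constructor
    · exact fun hw => hw.1
    · rintro rfl
      simp [h.1, h.2]
  · rw [Finset.card_eq_zero, Finset.eq_empty_iff_forall_notMem]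
    intro w hw
    simp only [Finset.mem_inter, Finset.mem_singleton, Finset.mem_filter, Finset.mem_univ] at hw
    obtain ⟨rfl, h1, h2⟩ := hw
    exact h ⟨h1.2.symm, h2.2.symm⟩

lemma triple_comm_fst_snd (x y z : X) (i j k : Fin (D + 1)) :
    S.triple x y z i j k = S.triple y x z j i k := by
  unfold triple
  congr 1
  ext w
  simp
  tauto

lemma triple_comm_fst_trd (x y z : X) (i j k : Fin (D + 1)) :
    S.triple x y z i j k = S.triple z y x k j i := by
  unfold triple
  congr 1
  ext w
  simp
  tauto

variable {S} {E : Fin (D + 1) → Matrix X X ℝ}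
  {Q : Matrix (Fin (D + 1)) (Fin (D + 1)) ℝ} {q : Fin (D + 1) → Fin (D + 1) → Fin (D + 1) → ℝ}
  {b c : Fin D → ℝ}

lemma IsSecondEigenmatrix.apply_eq (hQ : S.IsSecondEigenmatrix E Q) (a : Fin (D + 1)) (x y : X) :
    E a x y = (Fintype.card X : ℝ)⁻¹ * Q (S.rel x y) a := by
  rw [hQ a]
  simp [Matrix.sum_apply, adj]

lemma IsSecondEigenmatrix.apply_comm (hQ : S.IsSecondEigenmatrix E Q) (a : Fin (D + 1)) (x y : X) :
    E a x y = E a y x := by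
  rw [hQ.apply_eq, hQ.apply_eq, S.rel_symm]

variable [DecidableEq X]

lemma IsIdempotentOrdering.mul_eq (hE : S.IsIdempotentOrdering E) (a b : Fin (D + 1)) :
    E a * E b = if a = b then E a else 0 := by
  split_ifs with h
  · rw [← h, hE.idem]
  · exact hE.orthogonal a b h

lemma IsQPolynomialWithKreinArray.sum_apply_mul_apply
    (h : S.IsQPolynomialWithKreinArray E Q q b c) (a d : Fin (D + 1)) (x y : X) :
    ∑ w, E a x w * E d y w = if a = d then E a x y else 0 := by
  have h1 := congrFun (congrFun (h.idempotents.mul_eq a d) x) y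
  rw [Matrix.mul_apply] at h1
  rw [Finset.sum_congr rfl fun w _ => by rw [h.eigenmatrix.apply_comm d y w], h1]
  split_ifs <;> rfl

/-- The intersection numbers in terms of the second eigenmatrix. -/
lemma IsQPolynomialWithKreinArray.sum_mul_p (h : S.IsQPolynomialWithKreinArray E Q q b c)
    (a d k : Fin (D + 1)) :
    ∑ i, ∑ j, Q i a * Q j d * S.p i j k = if a = d then (Fintype.card X : ℝ) * Q k a else 0 := by
  obtain ⟨x, y, rfl⟩ := S.rel_nonempty k
  have hN := S.card_pos.ne'
  have h1 := h.sum_apply_mul_apply a d x y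
  simp only [h.eigenmatrix.apply_eq] at h1
  rw [S.sum_comp_rel (fun i j => (Fintype.card X : ℝ)⁻¹ * Q i a *
    ((Fintype.card X : ℝ)⁻¹ * Q j d)) x y] at h1
  have h2 : ∑ i, ∑ j, Q i a * Q j d * S.p i j (S.rel x y) = (Fintype.card X : ℝ) ^ 2 *
      ∑ i, ∑ j, (Fintype.card X : ℝ)⁻¹ * Q i a * ((Fintype.card X : ℝ)⁻¹ * Q j d) *
        S.p i j (S.rel x y) := by
    simp only [Finset.mul_sum]
    refine Finset.sum_congr rfl fun i _ => Finset.sum_congr rfl fun j _ => ?_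
    field_simp
  rw [h2, h1]
  split_ifs
  · field_simp
  · simp

lemma IsQPolynomialWithKreinArray.mul_eq_sum (h : S.IsQPolynomialWithKreinArray E Q q b c)
    (i a d : Fin (D + 1)) : Q i a * Q i d = ∑ k, q a d k * Q i k := by
  obtain ⟨x, y, rfl⟩ := S.rel_nonempty i
  have hN := S.card_pos.ne'
  have h1 := congrFun (congrFun (h.krein a d) x) y
  simp only [Matrix.hadamard_apply, Matrix.smul_apply, Matrix.sum_apply, h.eigenmatrix.apply_eq,
    smul_eq_mul] at h1
  have h2 : ∑ k, q a d k * ((Fintype.card X : ℝ)⁻¹ * Q (S.rel x y) k) =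
      (Fintype.card X : ℝ)⁻¹ * ∑ k, q a d k * Q (S.rel x y) k := by
    rw [Finset.mul_sum]
    exact Finset.sum_congr rfl fun k _ => by ring
  rw [h2] at h1
  field_simp at h1
  exact h1

lemma IsQPolynomialWithKreinArray.apply_col_zero (h : S.IsQPolynomialWithKreinArray E Q q b c)
    (i : Fin (D + 1)) : Q i 0 = 1 := by
  obtain ⟨x, y, rfl⟩ := S.rel_nonempty i
  have hN := S.card_pos.ne'
  have h1 := congrFun (congrFun h.idempotents.zero_eq x) y
  rw [h.eigenmatrix.apply_eq, Matrix.of_apply] at h1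
  field_simp at h1
  exact h1

/-- The multiplicities are positive. -/
lemma IsQPolynomialWithKreinArray.mult_pos (h : S.IsQPolynomialWithKreinArray E Q q b c)
    (a : Fin (D + 1)) : 0 < Q 0 a := by
  have hN := S.card_pos
  -- Each row of E_a has squared norm m_a/|X|, so m_a ≤ 0 would make E_a zero.
  have h1 : ∀ x, ∑ w, E a x w * E a x w = (Fintype.card X : ℝ)⁻¹ * Q 0 a := by
    intro x
    rw [h.sum_apply_mul_apply, if_pos rfl, h.eigenmatrix.apply_eq, S.rel_self]
  by_contra hneg
  apply h.idempotents.ne_zero a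
  ext x w
  have h2 : ∑ w, E a x w * E a x w ≤ 0 := by
    rw [h1]
    exact mul_nonpos_of_nonneg_of_nonpos (inv_nonneg.2 hN.le) (not_lt.1 hneg)
  have h3 := (Finset.sum_eq_zero_iff_of_nonneg fun w _ => mul_self_nonneg (E a x w)).1
    (le_antisymm h2 (Finset.sum_nonneg fun w _ => mul_self_nonneg _)) w (Finset.mem_univ _)
  simpa using h3

lemma IsQPolynomialWithKreinArray.sum_mult (h : S.IsQPolynomialWithKreinArray E Q q b c) :
    ∑ a, Q 0 a = Fintype.card X := by
  have hN := S.card_pos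
  obtain ⟨x, -, -⟩ := S.rel_nonempty 0
  have h1 := congrFun (congrFun h.idempotents.sum_eq_one x) x
  simp only [Matrix.sum_apply, h.eigenmatrix.apply_eq, S.rel_self, Matrix.one_apply_eq,
    ← Finset.mul_sum] at h1
  field_simp at h1
  exact h1

/-- `sum_mul_p` at k = 0 reads Qᵀ (p_{ij}^0) Q = |X| diag(m_a), which is invertible because
multiplicities are positive. -/
lemma IsQPolynomialWithKreinArray.isUnit_eigenmatrix
    (h : S.IsQPolynomialWithKreinArray E Q q b c) : IsUnit Q := by
  have h1 : Q.transpose * (Matrix.of fun i j => (S.p i j 0 : ℝ)) * Q =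
      Matrix.diagonal fun a => (Fintype.card X : ℝ) * Q 0 a := by
    ext a d
    rw [Matrix.diagonal_apply, ← h.sum_mul_p a d 0]
    simp only [Matrix.mul_apply, Matrix.transpose_apply, Matrix.of_apply, Finset.sum_mul]
    rw [Finset.sum_comm]
    exact Finset.sum_congr rfl fun i _ => Finset.sum_congr rfl fun j _ => by ring
  have h2 : IsUnit (Matrix.diagonal fun a => (Fintype.card X : ℝ) * Q 0 a) := by
    rw [Matrix.isUnit_diagonal, Pi.isUnit_iff]
    exact fun a => (mul_pos S.card_pos (h.mult_pos a)).ne'.isUnit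
  rw [← h1, Matrix.isUnit_iff_isUnit_det, Matrix.det_mul] at h2
  exact (Matrix.isUnit_iff_isUnit_det _).2 (isUnit_of_mul_isUnit_right h2)

/-- The columns of the second eigenmatrix are linearly independent. -/
lemma IsQPolynomialWithKreinArray.eq_zero_of_sum_col
    (h : S.IsQPolynomialWithKreinArray E Q q b c) {f : Fin (D + 1) → ℝ}
    (hf : ∀ i, ∑ a, f a * Q i a = 0) : f = 0 := by
  apply Matrix.mulVec_injective_of_isUnit h.isUnit_eigenmatrix
  ext i
  simpa [Matrix.mulVec, dotProduct, mul_comm] using hf i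

/-- The rows of the second eigenmatrix are linearly independent. -/
lemma IsQPolynomialWithKreinArray.eq_zero_of_sum_row
    (h : S.IsQPolynomialWithKreinArray E Q q b c) {f : Fin (D + 1) → ℝ}
    (hf : ∀ a, ∑ i, Q i a * f i = 0) : f = 0 := by
  apply Matrix.vecMul_injective_of_isUnit h.isUnit_eigenmatrix
  ext i
  simpa [Matrix.vecMul, dotProduct, mul_comm] using hf i

lemma IsQPolynomialWithKreinArray.sum_apply_mul_apply_all
    (h : S.IsQPolynomialWithKreinArray E Q q b c) (a d : Fin (D + 1)) :
    ∑ v, ∑ w, E a v w * E d v w = if a = d then Q 0 a else 0 := by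
  have hN := S.card_pos.ne'
  simp only [h.sum_apply_mul_apply]
  split_ifs
  · simp only [h.eigenmatrix.apply_eq, S.rel_self, Finset.sum_const, Finset.card_univ,
      nsmul_eq_mul]
    field_simp
  · simp

/-- The left side is symmetric in the three indices; this yields both `krein_symm` and the vanishing
of triple products. -/
lemma IsQPolynomialWithKreinArray.sum_hadamard
    (h : S.IsQPolynomialWithKreinArray E Q q b c) (a d e : Fin (D + 1)) :
    ∑ v, ∑ w, E a v w * E d v w * E e v w = (Fintype.card X : ℝ)⁻¹ * (q a d e * Q 0 e) := by
  have h1 : ∀ v w, E a v w * E d v w * E e v w =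
      ∑ k, (Fintype.card X : ℝ)⁻¹ * (q a d k * (E k v w * E e v w)) := by
    intro v w
    have h2 := congrFun (congrFun (h.krein a d) v) w
    simp only [Matrix.hadamard_apply, Matrix.smul_apply, Matrix.sum_apply, smul_eq_mul] at h2
    rw [h2, mul_assoc, Finset.sum_mul, Finset.mul_sum]
    exact Finset.sum_congr rfl fun k _ => by ring
  simp_rw [h1]
  rw [Finset.sum_congr rfl fun v _ => Finset.sum_comm, Finset.sum_comm]
  simp_rw [← Finset.mul_sum, h.sum_apply_mul_apply_all]
  simp

lemma IsQPolynomialWithKreinArray.krein_symm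
    (h : S.IsQPolynomialWithKreinArray E Q q b c) (a d e : Fin (D + 1)) :
    q a d e * Q 0 e = q a e d * Q 0 d := by
  have h1 := h.sum_hadamard a d e
  have h2 := h.sum_hadamard a e d
  have h3 : ∑ v, ∑ w, E a v w * E d v w * E e v w = ∑ v, ∑ w, E a v w * E e v w * E d v w :=
    Finset.sum_congr rfl fun v _ => Finset.sum_congr rfl fun w _ => by ring
  rw [h1, h2] at h3
  exact mul_left_cancel₀ (inv_ne_zero S.card_pos.ne') h3

/-- A vanishing Krein parameter forces the vanishing of all triple products of the corresponding
idempotents. -/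
lemma IsQPolynomialWithKreinArray.sum_triple_product_eq_zero
    (h : S.IsQPolynomialWithKreinArray E Q q b c) {a d e : Fin (D + 1)} (hq : q a d e = 0)
    (x y z : X) : ∑ w, E a x w * E d y w * E e z w = 0 := by
  have hcomm := h.eigenmatrix.apply_comm
  -- Expanding the square and summing over x, y, z collapses each factor by E² = E. The sum of
  -- squares is thus a multiple of q_{ad}^e, so q_{ad}^e = 0 makes every square vanish.
  have h1 : ∑ x, ∑ y, ∑ z, (∑ w, E a x w * E d y w * E e z w) ^ 2 =
      ∑ v, ∑ w, E a v w * E d v w * E e v w := by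
    have h2 : ∀ x y z, (∑ w, E a x w * E d y w * E e z w) ^ 2 =
        ∑ v, ∑ w, (E a v x * E a w x) * (E d v y * E d w y) * (E e v z * E e w z) := by
      intro x y z
      rw [sq, Finset.sum_mul_sum]
      refine Finset.sum_congr rfl fun v _ => Finset.sum_congr rfl fun w _ => ?_
      rw [hcomm a x v, hcomm a x w, hcomm d y v, hcomm d y w, hcomm e z v, hcomm e z w]
      ring
    have h3 : ∀ v w, E a v w * E d v w * E e v w =
        ∑ x, ∑ y, ∑ z, (E a v x * E a w x) * (E d v y * E d w y) * (E e v z * E e w z) := by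
      intro v w
      have ha := h.sum_apply_mul_apply a a v w
      have hd := h.sum_apply_mul_apply d d v w
      have he := h.sum_apply_mul_apply e e v w
      rw [if_pos rfl] at ha hd he
      rw [← ha, ← hd, ← he]
      simp only [Finset.sum_mul, Finset.mul_sum]
      rw [Finset.sum_congr rfl fun _ _ => Finset.sum_comm, Finset.sum_comm]
      exact Finset.sum_congr rfl fun _ _ => Finset.sum_comm
    simp_rw [h2, h3]
    simp_rw [← Finset.sum_product']
    refine Finset.sum_bij' 
      (fun i _ => (i.2.2.2.1, i.2.2.2.2, i.1, i.2.1, i.2.2.1))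
      (fun i _ => (i.2.2.1, i.2.2.2.1, i.2.2.2.2, i.1, i.2.1)) ?_ ?_ ?_ ?_ ?_ <;> simp
  rw [h.sum_hadamard, hq, zero_mul, mul_zero] at h1
  rw [Finset.sum_eq_zero_iff_of_nonneg fun _ _ => Finset.sum_nonneg fun _ _ =>
    Finset.sum_nonneg fun _ _ => sq_nonneg _] at h1
  have h2 := h1 x (Finset.mem_univ _)
  rw [Finset.sum_eq_zero_iff_of_nonneg fun _ _ => Finset.sum_nonneg fun _ _ => sq_nonneg _] at h2
  have h3 := h2 y (Finset.mem_univ _)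
  rw [Finset.sum_eq_zero_iff_of_nonneg fun _ _ => sq_nonneg _] at h3
  exact pow_eq_zero_iff two_ne_zero |>.1 (h3 z (Finset.mem_univ _))

/-- The triple intersection numbers solve the system of linear equations. -/
theorem IsQPolynomialWithKreinArray.isTripleSolution
    (h : S.IsQPolynomialWithKreinArray E Q q b c) (x y z : X) :
    S.IsTripleSolution Q q (S.rel x y) (S.rel x z) (S.rel y z)
      (fun i j k => (S.triple x y z i j k : ℝ)) where
  nonneg _ _ _ := Nat.cast_nonneg _
  sum_fst := S.sum_triple_fst x y z
  sum_snd := S.sum_triple_snd x y z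
  sum_trd := S.sum_triple_trd x y z
  zero_fst j k := by
    rw [triple_zero_fst]
    push_cast
    rfl
  zero_snd i k := by
    rw [triple_comm_fst_snd, triple_zero_fst, S.rel_symm y x]
    push_cast
    rfl
  zero_trd i j := by
    rw [triple_comm_fst_trd, triple_zero_fst, S.rel_symm z x, S.rel_symm z y]
    simp only [and_comm]
    push_cast
    rfl
  krein a d e hq := by
    have hN := S.card_pos.ne'
    have h1 := h.sum_triple_product_eq_zero hq x y z
    simp only [h.eigenmatrix.apply_eq] at h1
    rw [← S.sum_comp_rel_triple (fun i j k => Q i a * Q j d * Q k e) x y z]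
    have h2 : ∀ w, Q (S.rel x w) a * Q (S.rel y w) d * Q (S.rel z w) e =
        (Fintype.card X : ℝ) ^ 3 * ((Fintype.card X : ℝ)⁻¹ * Q (S.rel x w) a *
          ((Fintype.card X : ℝ)⁻¹ * Q (S.rel y w) d) *
          ((Fintype.card X : ℝ)⁻¹ * Q (S.rel z w) e)) := by
      intro w
      field_simp
    simp_rw [h2]
    rw [← Finset.mul_sum, h1, mul_zero]

end General

end AssociationScheme

namespace AssociationScheme

/-! ### Tridiagonality of the Krein parameters q_{1i}^k. -/

section QPolynomial

variable {X : Type*} [Fintype X] [DecidableEq X] {D : ℕ} {S : AssociationScheme X D}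
  {E : Fin (D + 1) → Matrix X X ℝ} {Q : Matrix (Fin (D + 1)) (Fin (D + 1)) ℝ}
  {q : Fin (D + 1) → Fin (D + 1) → Fin (D + 1) → ℝ} {b c : Fin D → ℝ}

/-- In a `Q`-polynomial ordering, the polynomials of degree less than `n` in the first column of `Q`
are combinations of the first `n` columns. -/
lemma IsQPolynomial.exists_eval_eq_sum (hQ : IsQPolynomial Q) (n : ℕ) (hn : n ≤ D + 1)
    (f : Polynomial ℝ) (hf : f.degree < n) :
    ∃ u : Fin (D + 1) → ℝ, (∀ i : Fin (D + 1), n ≤ i → u i = 0) ∧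
      ∀ j, f.eval (Q j 1) = ∑ i, u i * Q j i := by
  induction n generalizing f with
  | zero =>
    have h0 : f = 0 := by
      rw [← Polynomial.degree_eq_bot]
      exact (Nat.WithBot.lt_zero_iff).1 (by simpa using hf)
    exact ⟨0, fun _ _ => rfl, fun j => by simp [h0]⟩
  | succ n ih =>
    obtain ⟨v, hv, hvQ⟩ := hQ ⟨n, hn⟩
    have hvn : v.coeff n ≠ 0 := Polynomial.coeff_ne_zero_of_eq_degree hv
    set a := f.coeff n / v.coeff n with ha
    obtain ⟨u, hu, huQ⟩ := ih (by omega) (f - Polynomial.C a * v) (by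
      rw [Polynomial.degree_lt_iff_coeff_zero]
      intro m hm
      rw [Polynomial.coeff_sub, Polynomial.coeff_C_mul]
      rcases hm.eq_or_lt with rfl | hm
      · rw [ha, div_mul_cancel₀ _ hvn, sub_self]
      · rw [(Polynomial.degree_lt_iff_coeff_zero _ _).1 hf m hm,
          Polynomial.coeff_eq_zero_of_degree_lt (by rw [hv]; exact_mod_cast hm), mul_zero,
          sub_zero])
    refine ⟨u + Pi.single ⟨n, hn⟩ a, fun i hi => ?_, fun j => ?_⟩
    · have h1 : i ≠ ⟨n, hn⟩ := by
        rintro rfl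
        simp at hi
      rw [Pi.add_apply, Pi.single_eq_of_ne h1, hu i (by omega), add_zero]
    · have h1 := huQ j
      rw [Polynomial.eval_sub, Polynomial.eval_mul, Polynomial.eval_C, ← hvQ j] at h1
      simp only [Pi.add_apply, add_mul, Finset.sum_add_distrib, ← h1, Pi.single_apply, ite_mul,
        zero_mul, Finset.sum_ite_eq', Finset.mem_univ, if_true]
      ring

/-- Multiplying v_i^* by the variable gives degree i+1, so the product of columns 1 and i uses only
columns up to i+1; independence of the columns identifies the coefficients with q_{1i}^k. -/
lemma IsQPolynomialWithKreinArray.krein_one_eq_zero_of_lt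
    (h : S.IsQPolynomialWithKreinArray E Q q b c) {i k : Fin (D + 1)} (hik : (i : ℕ) + 1 < k) :
    q 1 i k = 0 := by
  obtain ⟨v, hv, hvQ⟩ := h.qPolynomial i
  obtain ⟨u, hu, huQ⟩ := h.qPolynomial.exists_eval_eq_sum (i + 2) (by omega) (Polynomial.X * v) (by
    rw [Polynomial.degree_mul, hv, Polynomial.degree_X]
    norm_cast
    omega)
  have h1 : q 1 i - u = 0 := h.eq_zero_of_sum_col fun j => by
    have h2 := h.mul_eq_sum j 1 i
    have h3 := huQ j
    rw [Polynomial.eval_mul, Polynomial.eval_X, ← hvQ j] at h3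
    simp only [Pi.sub_apply, sub_mul, Finset.sum_sub_distrib]
    linarith
  have h2 := congrFun h1 k
  rw [Pi.sub_apply, hu k (by omega), sub_zero] at h2
  exact h2

lemma IsQPolynomialWithKreinArray.krein_one_eq_zero_of_gt
    (h : S.IsQPolynomialWithKreinArray E Q q b c) {i k : Fin (D + 1)} (hik : (k : ℕ) + 1 < i) :
    q 1 i k = 0 := by
  have h1 := h.krein_symm 1 i k
  rw [h.krein_one_eq_zero_of_lt hik, zero_mul] at h1
  exact (mul_eq_zero.1 h1).resolve_right (h.mult_pos k).ne'

/-- Row 0 of the product formula reads m_1 m_i = ∑ q_{1i}^k m_k, and `krein_symm` turns each term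
into q_{1k}^i m_i. -/
lemma IsQPolynomialWithKreinArray.sum_krein_one
    (h : S.IsQPolynomialWithKreinArray E Q q b c) (i : Fin (D + 1)) :
    ∑ k, q 1 k i = Q 0 1 := by
  have h1 := h.mul_eq_sum 0 1 i
  simp_rw [h.krein_symm 1 i, ← Finset.sum_mul] at h1
  exact (mul_right_cancel₀ (h.mult_pos i).ne' h1).symm

end QPolynomial

/-! ### The recursion for Q-bipartite schemes with five classes. -/

/-- The three-term recursion for the rows of the second eigenmatrix of a `Q`-bipartite scheme with
five classes. -/
def ThreeTermRecursion (b c : Fin 5 → ℝ) (v : Fin 6 → ℝ) : Prop :=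
  v 0 = 1 ∧ v 1 * v 1 = b 0 + c 1 * v 2 ∧ v 1 * v 2 = b 1 * v 1 + c 2 * v 3 ∧
    v 1 * v 3 = b 2 * v 2 + c 3 * v 4 ∧ v 1 * v 4 = b 3 * v 3 + c 4 * v 5 ∧ v 1 * v 5 = b 4 * v 4

lemma ThreeTermRecursion.eq {b c : Fin 5 → ℝ} {v w : Fin 6 → ℝ} (hv : ThreeTermRecursion b c v)
    (hw : ThreeTermRecursion b c w) (hc : ∀ i, c i ≠ 0) (h1 : v 1 = w 1) : v = w := by
  obtain ⟨v0, v2, v3, v4, v5, -⟩ := hv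
  obtain ⟨w0, w2, w3, w4, w5, -⟩ := hw
  have h2 : v 2 = w 2 := mul_left_cancel₀ (hc 1) (by rw [h1] at v2; linarith)
  have h3 : v 3 = w 3 := mul_left_cancel₀ (hc 2) (by rw [h1, h2] at v3; linarith)
  have h4 : v 4 = w 4 := mul_left_cancel₀ (hc 3) (by rw [h1, h2, h3] at v4; linarith)
  have h5 : v 5 = w 5 := mul_left_cancel₀ (hc 4) (by rw [h1, h3, h4] at v5; linarith)
  ext i
  fin_cases i <;> simp [v0, w0, h1, h2, h3, h4, h5]

variable {X : Type*} [Fintype X] [DecidableEq X] {S : AssociationScheme X 5}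
  {E : Fin 6 → Matrix X X ℝ} {Q : Matrix (Fin 6) (Fin 6) ℝ}
  {q : Fin 6 → Fin 6 → Fin 6 → ℝ} {b c : Fin 5 → ℝ}

/-- The hypotheses on b and c make the off-diagonal entries already add up to m_1 = b_0^*, so
`sum_krein_one` leaves a_i^* = 0. -/
lemma IsQPolynomialWithKreinArray.threeTermRecursion
    (h : S.IsQPolynomialWithKreinArray E Q q b c) (hc : c 0 = 1) (h1 : b 1 + c 0 = b 0)
    (h2 : b 2 + c 1 = b 0) (h3 : b 3 + c 2 = b 0) (h4 : b 4 + c 3 = b 0) (h5 : c 4 = b 0)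
    (j : Fin 6) : ThreeTermRecursion b c (Q j) := by
  have lt : ∀ i k : Fin 6, (i : ℕ) + 1 < k → q 1 i k = 0 := fun _ _ => h.krein_one_eq_zero_of_lt
  have gt : ∀ i k : Fin 6, (k : ℕ) + 1 < i → q 1 i k = 0 := fun _ _ => h.krein_one_eq_zero_of_gt
  have b0 : q 1 1 0 = b 0 := h.b_eq 0
  have b1 : q 1 2 1 = b 1 := h.b_eq 1
  have b2 : q 1 3 2 = b 2 := h.b_eq 2
  have b3 : q 1 4 3 = b 3 := h.b_eq 3
  have b4 : q 1 5 4 = b 4 := h.b_eq 4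
  have c0 : q 1 0 1 = c 0 := h.c_eq 0
  have c1 : q 1 1 2 = c 1 := h.c_eq 1
  have c2 : q 1 2 3 = c 2 := h.c_eq 2
  have c3 : q 1 3 4 = c 3 := h.c_eq 3
  have c4 : q 1 4 5 = c 4 := h.c_eq 4
  have z02 := lt 0 2 (by decide)
  have z03 := lt 0 3 (by decide)
  have z04 := lt 0 4 (by decide)
  have z05 := lt 0 5 (by decide)
  have z13 := lt 1 3 (by decide)
  have z14 := lt 1 4 (by decide)
  have z15 := lt 1 5 (by decide)
  have z24 := lt 2 4 (by decide)
  have z25 := lt 2 5 (by decide)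
  have z35 := lt 3 5 (by decide)
  have z20 := gt 2 0 (by decide)
  have z30 := gt 3 0 (by decide)
  have z40 := gt 4 0 (by decide)
  have z50 := gt 5 0 (by decide)
  have z31 := gt 3 1 (by decide)
  have z41 := gt 4 1 (by decide)
  have z51 := gt 5 1 (by decide)
  have z42 := gt 4 2 (by decide)
  have z52 := gt 5 2 (by decide)
  have z53 := gt 5 3 (by decide)
  have m1 : Q 0 1 = b 0 := by
    have := h.krein_symm 1 0 1
    rw [b0, c0, hc, h.apply_col_zero] at this
    linarith
  have s : ∀ i : Fin 6, ∑ k : Fin 6, q 1 k i = Q 0 1 := h.sum_krein_one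
  simp only [Fin.sum_univ_six, m1] at s
  have a1 : q 1 1 1 = 0 := by linarith [s 1]
  have a2 : q 1 2 2 = 0 := by linarith [s 2]
  have a3 : q 1 3 3 = 0 := by linarith [s 3]
  have a4 : q 1 4 4 = 0 := by linarith [s 4]
  have a5 : q 1 5 5 = 0 := by linarith [s 5]
  have e : ∀ i : Fin 6, Q j 1 * Q j i = ∑ k : Fin 6, q 1 i k * Q j k := h.mul_eq_sum j 1
  simp only [Fin.sum_univ_six] at e
  refine ⟨h.apply_col_zero j, ?_, ?_, ?_, ?_, ?_⟩
  · rw [e 1, b0, a1, c1, z13, z14, z15, h.apply_col_zero]; ring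
  · rw [e 2, z20, b1, a2, c2, z24, z25]; ring
  · rw [e 3, z30, z31, b2, a3, c3, z35]; ring
  · rw [e 4, z40, z41, z42, b3, a4, c4]; ring
  · rw [e 5, z50, z51, z52, z53, b4, a5]; ring

/-- Matching values defines a strictly increasing self-map of `Fin n`, necessarily the identity. -/
lemma eq_of_strictAnti_of_forall_exists {n : ℕ} {f g : Fin n → ℝ} (hf : StrictAnti f)
    (hg : StrictAnti g) (h : ∀ i, ∃ j, f i = g j) : f = g := by
  choose φ hφ using h
  have h1 : StrictMono φ := fun i j hij => by
    have h2 := hf hij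
    rw [hφ, hφ, hg.lt_iff_gt] at h2
    exact h2
  have h2 : Function.Surjective φ := Finite.surjective_of_injective h1.injective
  have h3 : φ = id := (h1.range_inj strictMono_id).1 (by simp [h2.range_eq])
  ext i
  rw [hφ, h3, id]

end AssociationScheme

/-! ### The explicit eigenmatrix and intersection numbers of the family. -/

/-- The second eigenmatrix of the schemes in the family, where `r = s ^ 2`. -/
noncomputable def familyQ (s : ℝ) : Matrix (Fin 6) (Fin 6) ℝ :=
  !![1, (s ^ 4 + 1) / 2, s ^ 2 * (s ^ 2 + 1) ^ 2 / 2, s ^ 2 * (s ^ 4 + 1), s ^ 2 * (s ^ 4 + 1) / 2,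
      (s ^ 4 + 1) / 2;
    1, (s ^ 4 + 1) / (2 * s), (s ^ 4 - 1) / 2, 0, -(s ^ 4 + 1) / 2, -(s ^ 4 + 1) / (2 * s);
    1, (s ^ 4 + 1) / (2 * s ^ 2), -(s ^ 2 + 1) ^ 2 / (2 * s ^ 2), -(s ^ 4 + 1) / s ^ 2,
      (s ^ 4 + 1) / (2 * s ^ 2), (s ^ 4 + 1) / (2 * s ^ 2);
    1, -(s ^ 4 + 1) / (2 * s ^ 2), -(s ^ 2 + 1) ^ 2 / (2 * s ^ 2), (s ^ 4 + 1) / s ^ 2,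
      (s ^ 4 + 1) / (2 * s ^ 2), -(s ^ 4 + 1) / (2 * s ^ 2);
    1, -(s ^ 4 + 1) / (2 * s), (s ^ 4 - 1) / 2, 0, -(s ^ 4 + 1) / 2, (s ^ 4 + 1) / (2 * s);
    1, -(s ^ 4 + 1) / 2, s ^ 2 * (s ^ 2 + 1) ^ 2 / 2, -(s ^ 2 * (s ^ 4 + 1)),
      s ^ 2 * (s ^ 4 + 1) / 2, -(s ^ 4 + 1) / 2]

/-- The intersection numbers `p_{ij}^1` of the schemes in the family. -/
noncomputable def familyP (r : ℝ) : Matrix (Fin 6) (Fin 6) ℝ :=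
  !![0, 1, 0, 0, 0, 0;
    1, (r - 1) / 2, r ^ 2, 0, (r - 1) / 2, 0;
    0, r ^ 2, r ^ 2 * (r - 1) / 2, r ^ 2 * (r - 1) / 2, 0, 0;
    0, 0, r ^ 2 * (r - 1) / 2, r ^ 2 * (r - 1) / 2, r ^ 2, 0;
    0, (r - 1) / 2, 0, r ^ 2, (r - 1) / 2, 1;
    0, 0, 0, 0, 1, 0]

namespace AssociationScheme

lemma familyC_ne_zero {r : ℝ} (hr : 1 < r) (i : Fin 5) : familyC r i ≠ 0 := by
  have h1 : 0 < r - 1 := by linarith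
  refine ne_of_gt ?_
  fin_cases i
  · exact one_pos
  · change 0 < (r - 1) * (r ^ 2 + 1) / (2 * r * (r + 1))
    positivity
  · change 0 < (r + 1) * (r ^ 2 + 1) / (4 * r)
    positivity
  · change 0 < (r - 1) * (r ^ 2 + 1) / (2 * r)
    positivity
  · change 0 < (r ^ 2 + 1) / 2
    positivity

lemma threeTermRecursion_familyQ {s : ℝ} (hs : 1 < s) (j : Fin 6) :
    ThreeTermRecursion (familyB (s ^ 2)) (familyC (s ^ 2)) (familyQ s j) := by
  have h0 : s ≠ 0 := by positivity
  have h1 : s ^ 2 + 1 ≠ 0 := by positivity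
  fin_cases j <;> refine ⟨?_, ?_, ?_, ?_, ?_, ?_⟩ <;>
    simp [familyQ, familyB, familyC] <;> field_simp <;> first | ring1 | (ring_nf; simp)

lemma strictAnti_familyQ {s : ℝ} (hs : 1 < s) : StrictAnti fun j => familyQ s j 1 := by
  have h0 : 0 < s := by positivity
  have h1 : 0 < (s ^ 4 + 1) / (2 * s ^ 2) := by positivity
  have h2 : (s ^ 4 + 1) / (2 * s ^ 2) < (s ^ 4 + 1) / (2 * s) := by
    gcongr
    nlinarith
  have h3 : (s ^ 4 + 1) / (2 * s) < (s ^ 4 + 1) / 2 := by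
    gcongr
    linarith
  rw [Fin.strictAnti_iff_succ_lt]
  intro j
  fin_cases j
  · exact h3
  · exact h2
  · change -(s ^ 4 + 1) / (2 * s ^ 2) < (s ^ 4 + 1) / (2 * s ^ 2)
    rw [neg_div]
    linarith
  · change -(s ^ 4 + 1) / (2 * s) < -(s ^ 4 + 1) / (2 * s ^ 2)
    rw [neg_div, neg_div]
    linarith
  · change -(s ^ 4 + 1) / 2 < -(s ^ 4 + 1) / (2 * s)
    rw [neg_div, neg_div]
    linarith

lemma ThreeTermRecursion.exists_familyQ {s : ℝ} (hs : 1 < s) {v : Fin 6 → ℝ}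
    (hv : ThreeTermRecursion (familyB (s ^ 2)) (familyC (s ^ 2)) v) :
    ∃ j, v 1 = familyQ s j 1 := by
  have h0 : s ≠ 0 := by positivity
  have h1 : s ^ 2 + 1 ≠ 0 := by positivity
  obtain ⟨-, e2, e3, e4, e5, e6⟩ := hv
  set b := familyB (s ^ 2) with hb
  set c := familyC (s ^ 2) with hc
  set t := v 1
  -- Eliminating v 2, …, v 5 from the recursion leaves the characteristic polynomial of the
  -- tridiagonal Krein matrix, evaluated at t.
  have key : t * (t * (t * (t * (t * t - b 0) - b 1 * c 1 * t) - b 2 * c 2 * (t * t - b 0)) -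
      b 3 * c 3 * (t * (t * t - b 0) - b 1 * c 1 * t)) - b 4 * c 4 *
      (t * (t * (t * t - b 0) - b 1 * c 1 * t) - b 2 * c 2 * (t * t - b 0)) = 0 := by
    have w2 : t * t - b 0 = c 1 * v 2 := by linarith
    have w3 : t * (c 1 * v 2) - b 1 * c 1 * t = c 1 * c 2 * v 3 := by linear_combination c 1 * e3
    have w4 : t * (c 1 * c 2 * v 3) - b 2 * c 2 * (c 1 * v 2) = c 1 * c 2 * c 3 * v 4 := by
      linear_combination c 1 * c 2 * e4
    rw [w2, w3, w4]
    linear_combination c 1 * c 2 * c 3 * t * e5 + c 1 * c 2 * c 3 * c 4 * e6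
  have key2 : (t - (s ^ 4 + 1) / 2) * (t - (s ^ 4 + 1) / (2 * s)) *
      (t - (s ^ 4 + 1) / (2 * s ^ 2)) * (t + (s ^ 4 + 1) / (2 * s ^ 2)) *
      (t + (s ^ 4 + 1) / (2 * s)) * (t + (s ^ 4 + 1) / 2) = 0 := by
    rw [← key, hb, hc]
    simp [familyB, familyC]
    field_simp
    ring
  simp only [mul_eq_zero, sub_eq_zero, add_eq_zero_iff_eq_neg, or_assoc] at key2
  rcases key2 with h | h | h | h | h | h
  · exact ⟨0, h⟩
  · exact ⟨1, h⟩
  · exact ⟨2, h⟩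
  · exact ⟨3, by rw [h]; simp [familyQ]; ring⟩
  · exact ⟨4, by rw [h]; simp [familyQ]; ring⟩
  · exact ⟨5, by rw [h]; simp [familyQ]; ring⟩

lemma familyQ_rev (s : ℝ) (j a : Fin 6) :
    familyQ s j.rev a = (-1) ^ (a : ℕ) * familyQ s j a := by
  fin_cases j <;> fin_cases a <;> simp [familyQ, Fin.rev] <;> ring

set_option maxHeartbeats 4000000 in
-- This is `sum_mul_p` at k = 1 with |X| written as the sum of multiplicities; it lets `familyP` be
-- recognised without inverting Q.
lemma familyQ_mul_familyP {s : ℝ} (hs : 1 < s) (a d : Fin 6) :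
    ∑ i, ∑ j, familyQ s i a * familyQ s j d * familyP (s ^ 2) i j =
      if a = d then (∑ e, familyQ s 0 e) * familyQ s 1 a else 0 := by
  have h0 : s ≠ 0 := by positivity
  simp only [Fin.sum_univ_six]
  fin_cases a <;> fin_cases d <;> simp [familyQ, familyP] <;> field_simp <;> ring

end AssociationScheme

namespace AssociationScheme

/-! ### Consequences of the eigenmatrix: odd Krein parameters vanish, solutions are reversal
invariant. -/

section Family

variable {X : Type*} [Fintype X] [DecidableEq X] {S : AssociationScheme X 5}
  {E : Fin 6 → Matrix X X ℝ} {Q : Matrix (Fin 6) (Fin 6) ℝ}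
  {q : Fin 6 → Fin 6 → Fin 6 → ℝ} {s : ℝ}

lemma IsQPolynomialWithKreinArray.threeTermRecursion_family
    (h : S.IsQPolynomialWithKreinArray E Q q (familyB (s ^ 2)) (familyC (s ^ 2))) (hs : 1 < s)
    (j : Fin 6) : ThreeTermRecursion (familyB (s ^ 2)) (familyC (s ^ 2)) (Q j) := by
  have h0 : s ≠ 0 := by positivity
  have h1 : s ^ 2 + 1 ≠ 0 := by positivity
  apply h.threeTermRecursion <;> simp [familyB, familyC] <;> field_simp <;> ring

lemma IsQPolynomialWithKreinArray.eq_familyQ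
    (h : S.IsQPolynomialWithKreinArray E Q q (familyB (s ^ 2)) (familyC (s ^ 2))) (hs : 1 < s)
    (hQ : IsNaturalOrdering Q) : Q = familyQ s := by
  have h1 : (fun j => Q j 1) = fun j => familyQ s j 1 :=
    eq_of_strictAnti_of_forall_exists hQ (strictAnti_familyQ hs)
      fun j => (h.threeTermRecursion_family hs j).exists_familyQ hs
  refine funext fun j => ?_
  exact (h.threeTermRecursion_family hs j).eq (threeTermRecursion_familyQ hs j)
    (familyC_ne_zero (by nlinarith)) (congrFun h1 j)

/-- Comparing the product formula in rows j and `j.rev` gives a relation among columns with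
coefficients q_{ad}^k (1 - (-1)^{a+d+k}), all of which must vanish. -/
lemma IsQPolynomialWithKreinArray.krein_eq_zero_of_odd
    (h : S.IsQPolynomialWithKreinArray E (familyQ s) q (familyB (s ^ 2)) (familyC (s ^ 2)))
    {a d e : Fin 6} (hodd : Odd (a + d + e : ℕ)) : q a d e = 0 := by
  have h1 : (fun k : Fin 6 => q a d k * (1 - (-1) ^ (a + d + k : ℕ))) = 0 :=
    h.eq_zero_of_sum_col fun j => by
      have h2 := h.mul_eq_sum j a d
      have h3 := h.mul_eq_sum j.rev a d
      simp only [familyQ_rev] at h3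
      have h4 : ∀ k : Fin (5 + 1), q a d k * (1 - (-1) ^ (a + d + k : ℕ)) * familyQ s j k =
          q a d k * familyQ s j k -
            (-1) ^ (a + d : ℕ) * (q a d k * ((-1) ^ (k : ℕ) * familyQ s j k)) := by
        intro k
        rw [pow_add _ (a + d : ℕ)]
        ring
      rw [Finset.sum_congr rfl fun k _ => h4 k, Finset.sum_sub_distrib, ← Finset.mul_sum, ← h2,
        ← h3]
      have h5 : ((-1 : ℝ) ^ (a + d : ℕ)) * (-1) ^ (a + d : ℕ) = 1 := by
        rw [← mul_pow]
        simp
      rw [pow_add] at h5 ⊢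
      linear_combination (-familyQ s j a * familyQ s j d) * h5
  have h2 := congrFun h1 e
  simp only [hodd.neg_one_pow, Pi.zero_apply] at h2
  linarith

/-- Both arrays have the same transform under Q in each index, and independence of the rows, used
twice, makes this transform injective. -/
lemma IsQPolynomialWithKreinArray.p_one_eq_familyP
    (h : S.IsQPolynomialWithKreinArray E (familyQ s) q (familyB (s ^ 2)) (familyC (s ^ 2)))
    (hs : 1 < s) (i j : Fin 6) : (S.p i j 1 : ℝ) = familyP (s ^ 2) i j := by
  have h1 : ∀ i : Fin 6, (fun j : Fin 6 => (S.p i j 1 : ℝ) - familyP (s ^ 2) i j) = 0 := by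
    intro i
    refine h.eq_zero_of_sum_row fun d => ?_
    have h2 : (fun i : Fin 6 => ∑ j : Fin 6, familyQ s j d *
        ((S.p i j 1 : ℝ) - familyP (s ^ 2) i j)) = 0 := by
      refine h.eq_zero_of_sum_row fun a => ?_
      have h3 : ∑ i : Fin 6, ∑ j : Fin 6, familyQ s i a * familyQ s j d * (S.p i j 1 : ℝ) = _ :=
        h.sum_mul_p a d 1
      rw [← h.sum_mult] at h3
      have h4 := (familyQ_mul_familyP hs a d).symm
      have h5 := h3.trans h4
      simp only [Finset.mul_sum, mul_sub, Finset.sum_sub_distrib]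
      rw [sub_eq_zero]
      simpa only [mul_assoc] using h5
    exact congrFun h2 i
  exact sub_eq_zero.1 (congrFun (h1 i) j)

lemma IsQPolynomialWithKreinArray.eq_zero_of_sum_triple
    (h : S.IsQPolynomialWithKreinArray E Q q (familyB (s ^ 2)) (familyC (s ^ 2)))
    {U : Fin 6 → Fin 6 → Fin 6 → ℝ}
    (hU : ∀ a d e, ∑ i, ∑ j, ∑ k, Q i a * Q j d * Q k e * U i j k = 0) (i j k : Fin 6) :
    U i j k = 0 := by
  have h1 : ∀ d e, (fun i : Fin 6 => ∑ j : Fin 6, ∑ k : Fin 6, Q j d * Q k e * U i j k) = 0 :=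
    fun d e => h.eq_zero_of_sum_row fun a => by
      rw [← hU a d e]
      simp only [Finset.mul_sum, mul_assoc]
  have h2 : ∀ e i, (fun j : Fin 6 => ∑ k : Fin 6, Q k e * U i j k) = 0 :=
    fun e i => h.eq_zero_of_sum_row fun d => by
      refine Eq.trans ?_ (congrFun (h1 d e) i)
      simp only [Finset.mul_sum, mul_assoc]
  have h3 : (fun k : Fin 6 => U i j k) = 0 :=
    h.eq_zero_of_sum_row fun e => congrFun (h2 e i) j
  exact congrFun h3 k

/-- The vanishing of the Krein parameters with odd index sum makes the solutions of the system
invariant under reversing the order of the relations. -/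
lemma IsQPolynomialWithKreinArray.tripleSolution_rev
    (h : S.IsQPolynomialWithKreinArray E (familyQ s) q (familyB (s ^ 2)) (familyC (s ^ 2)))
    {x y z : Fin 6} {T : Fin 6 → Fin 6 → Fin 6 → ℝ}
    (hT : S.IsTripleSolution (familyQ s) q x y z T) (i j k : Fin 6) :
    T i.rev j.rev k.rev = T i j k := by
  refine sub_eq_zero.1 (h.eq_zero_of_sum_triple
    (U := fun i j k => T i.rev j.rev k.rev - T i j k) (fun a d e => ?_) i j k)
  -- Reversal multiplies the (a, d, e) transform of T by (-1)^{a+d+e}: even transforms are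
  -- unchanged, and odd ones are zero by the Krein equations.
  have h1 : ∑ i, ∑ j, ∑ k, familyQ s i a * familyQ s j d * familyQ s k e *
      T i.rev j.rev k.rev = (-1) ^ (a + d + e : ℕ) *
      ∑ i, ∑ j, ∑ k, familyQ s i a * familyQ s j d * familyQ s k e * T i j k := by
    rw [← Equiv.sum_comp Fin.revPerm]
    simp only [Finset.mul_sum]
    refine Finset.sum_congr rfl fun i _ => ?_
    rw [← Equiv.sum_comp Fin.revPerm]
    refine Finset.sum_congr rfl fun j _ => ?_
    rw [← Equiv.sum_comp Fin.revPerm]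
    refine Finset.sum_congr rfl fun k _ => ?_
    simp only [Fin.revPerm_apply, Fin.rev_rev, familyQ_rev]
    ring
  simp only [mul_sub, Finset.sum_sub_distrib]
  rw [h1]
  rcases Nat.even_or_odd (a + d + e : ℕ) with heven | hodd
  · rw [heven.neg_one_pow, one_mul, sub_self]
  · have := hT.krein a d e (h.krein_eq_zero_of_odd hodd)
    rw [this, mul_zero, sub_zero]

end Family

/-! ### Relabelling the relations into natural order. -/

section Reindex

variable {X : Type*} [Fintype X] {D : ℕ}

/-- Renaming the relations of a scheme by a permutation fixing `0`. -/
def reindex (S : AssociationScheme X D) (σ : Equiv.Perm (Fin (D + 1))) (hσ : σ 0 = 0) :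
    AssociationScheme X D where
  rel x y := σ.symm (S.rel x y)
  p i j k := S.p (σ i) (σ j) (σ k)
  rel_nonempty i := by
    obtain ⟨x, y, h⟩ := S.rel_nonempty (σ i)
    exact ⟨x, y, by rw [h, Equiv.symm_apply_apply]⟩
  rel_eq_zero_iff x y := by rw [Equiv.symm_apply_eq, hσ, S.rel_eq_zero_iff]
  rel_symm x y := by rw [S.rel_symm]
  card_eq_p i j k x y h := by
    simp only [Equiv.symm_apply_eq] at h ⊢
    exact S.card_eq_p _ _ _ x y h

lemma adj_reindex (S : AssociationScheme X D) (σ : Equiv.Perm (Fin (D + 1))) (hσ : σ 0 = 0)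
    (i : Fin (D + 1)) : (S.reindex σ hσ).adj i = S.adj (σ i) := by
  ext x y
  simp [adj, reindex, Equiv.symm_apply_eq]

lemma IsQPolynomialWithKreinArray.reindex [DecidableEq X] {S : AssociationScheme X D}
    {E : Fin (D + 1) → Matrix X X ℝ} {Q : Matrix (Fin (D + 1)) (Fin (D + 1)) ℝ}
    {q : Fin (D + 1) → Fin (D + 1) → Fin (D + 1) → ℝ} {b c : Fin D → ℝ}
    (h : S.IsQPolynomialWithKreinArray E Q q b c) (σ : Equiv.Perm (Fin (D + 1)))
    (hσ : σ 0 = 0) :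
    (S.reindex σ hσ).IsQPolynomialWithKreinArray E (fun i a => Q (σ i) a) q b c where
  idempotents :=
    { h.idempotents with
      mem_span := fun i => by
        have h1 : (S.reindex σ hσ).adj = S.adj ∘ σ := funext (S.adj_reindex σ hσ)
        rw [h1, σ.surjective.range_comp]
        exact h.idempotents.mem_span i }
  eigenmatrix i := by
    rw [h.eigenmatrix i, ← Equiv.sum_comp σ]
    simp only [adj_reindex]
  krein := h.krein
  qPolynomial i := by
    obtain ⟨v, hv, hvQ⟩ := h.qPolynomial i
    exact ⟨v, hv, fun j => hvQ (σ j)⟩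
  b_eq := h.b_eq
  c_eq := h.c_eq

/-- All columns are polynomials in column 1, so a repeated entry there would repeat a whole row of
Q. -/
lemma IsQPolynomialWithKreinArray.injective_col_one [DecidableEq X] {S : AssociationScheme X D}
    {E : Fin (D + 1) → Matrix X X ℝ} {Q : Matrix (Fin (D + 1)) (Fin (D + 1)) ℝ}
    {q : Fin (D + 1) → Fin (D + 1) → Fin (D + 1) → ℝ} {b c : Fin D → ℝ}
    (h : S.IsQPolynomialWithKreinArray E Q q b c) : Function.Injective fun j => Q j 1 := by
  intro i j hij
  by_contra hne
  have h1 : (Pi.single i 1 - Pi.single j 1 : Fin (D + 1) → ℝ) = 0 :=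
    h.eq_zero_of_sum_row fun a => by
      obtain ⟨v, -, hvQ⟩ := h.qPolynomial a
      simp only [Pi.sub_apply, mul_sub, Finset.sum_sub_distrib, Pi.single_apply, mul_ite, mul_one,
        mul_zero, Finset.sum_ite_eq', Finset.mem_univ, if_true]
      rw [hvQ i, hvQ j]
      simp only at hij
      rw [hij, sub_self]
  have h2 := congrFun h1 i
  simp [hne] at h2

lemma HasKreinArray.exists_isNaturalOrdering [DecidableEq X] {S : AssociationScheme X 5} {s : ℝ}
    (hs : 1 < s) (h : S.HasKreinArray (familyB (s ^ 2)) (familyC (s ^ 2))) :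
    ∃ (S' : AssociationScheme X 5) (E : Fin 6 → Matrix X X ℝ) (Q : Matrix (Fin 6) (Fin 6) ℝ)
      (q : Fin 6 → Fin 6 → Fin 6 → ℝ),
      S'.IsQPolynomialWithKreinArray E Q q (familyB (s ^ 2)) (familyC (s ^ 2)) ∧
        IsNaturalOrdering Q := by
  obtain ⟨E, Q, q, h⟩ := h
  set σ : Equiv.Perm (Fin 6) := Tuple.sort fun j => -Q j 1 with hσ
  have h1 : StrictAnti fun j => Q (σ j) 1 := by
    have h2 : Monotone ((fun j => -Q j 1) ∘ σ) := Tuple.monotone_sort _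
    have h3 : StrictMono ((fun j => -Q j 1) ∘ σ) := h2.strictMono_of_injective
      ((neg_injective.comp h.injective_col_one).comp σ.injective)
    exact fun i j hij => neg_lt_neg_iff.1 (h3 hij)
  have h2 : (fun j => Q (σ j) 1) = fun j => familyQ s j 1 :=
    eq_of_strictAnti_of_forall_exists h1 (strictAnti_familyQ hs)
      fun j => (h.threeTermRecursion_family hs (σ j)).exists_familyQ hs
  -- The identity relation keeps its label because Q_{01} = b_0^* is the largest of the six values.
  have h3 : σ 0 = 0 := by
    apply h.injective_col_one
    have h4 : Q (σ 0) 1 = familyQ s 0 1 := congrFun h2 0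
    have h5 := h.krein_symm 1 0 1
    have h6 : q 1 1 0 = familyB (s ^ 2) 0 := h.b_eq 0
    have h7 : q 1 0 1 = familyC (s ^ 2) 0 := h.c_eq 0
    rw [h6, h7, h.apply_col_zero] at h5
    simp only
    rw [h4]
    simp [familyQ, familyB, familyC] at h5 ⊢
    rw [h5]
    ring
  exact ⟨S.reindex σ h3, E, _, q, h.reindex σ h3, h1⟩

end Reindex

end AssociationScheme

/-! ### Solving the system for a triangle of R_1. -/

/-- The triple intersection numbers with respect to three vertices mutually in relation `R_1`. -/
noncomputable def familyTriple (r : ℝ) : Fin 6 → Fin 6 → Fin 6 → ℝ :=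
  let u := (r - 1) / 4
  let v := (r - 5) / 4
  let m := r ^ 2
  let e := r ^ 2 * (r - 1) / 4
  let f := r ^ 2 * (r - 5) / 4
  ![!![0, 0, 0, 0, 0, 0; 0, 1, 0, 0, 0, 0; 0, 0, 0, 0, 0, 0; 0, 0, 0, 0, 0, 0; 0, 0, 0, 0, 0, 0;
      0, 0, 0, 0, 0, 0],
    !![0, 1, 0, 0, 0, 0; 1, v, 0, 0, u, 0; 0, 0, m, 0, 0, 0; 0, 0, 0, 0, 0, 0; 0, u, 0, 0, u, 0;
      0, 0, 0, 0, 0, 0],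
    !![0, 0, 0, 0, 0, 0; 0, 0, m, 0, 0, 0; 0, m, f, e, 0, 0; 0, 0, e, e, 0, 0; 0, 0, 0, 0, 0, 0;
      0, 0, 0, 0, 0, 0],
    !![0, 0, 0, 0, 0, 0; 0, 0, 0, 0, 0, 0; 0, 0, e, e, 0, 0; 0, 0, e, f, m, 0; 0, 0, 0, m, 0, 0;
      0, 0, 0, 0, 0, 0],
    !![0, 0, 0, 0, 0, 0; 0, u, 0, 0, u, 0; 0, 0, 0, 0, 0, 0; 0, 0, 0, m, 0, 0; 0, u, 0, 0, v, 1;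
      0, 0, 0, 0, 1, 0],
    !![0, 0, 0, 0, 0, 0; 0, 0, 0, 0, 0, 0; 0, 0, 0, 0, 0, 0; 0, 0, 0, 0, 0, 0; 0, 0, 0, 0, 1, 0;
      0, 0, 0, 0, 0, 0]]

namespace AssociationScheme

section TripleSolution

variable {X : Type*} [Fintype X] [DecidableEq X] {S : AssociationScheme X 5}
  {E : Fin 6 → Matrix X X ℝ} {Q : Matrix (Fin 6) (Fin 6) ℝ}
  {q : Fin 6 → Fin 6 → Fin 6 → ℝ} {s : ℝ}

lemma forall_fin_six {P : Fin 6 → Prop} (h0 : P 0) (h1 : P 1) (h2 : P 2) (h3 : P 3) (h4 : P 4)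
    (h5 : P 5) (i : Fin 6) : P i := by
  fin_cases i <;> assumption

set_option maxHeartbeats 2000000 in
/-- The system of linear equations for a triangle of `R_1` has at most one nonnegative solution. -/
theorem IsQPolynomialWithKreinArray.tripleSolution_eq
    (h : S.IsQPolynomialWithKreinArray E (familyQ s) q (familyB (s ^ 2)) (familyC (s ^ 2)))
    (hs : 1 < s) {T : Fin 6 → Fin 6 → Fin 6 → ℝ}
    (hT : S.IsTripleSolution (familyQ s) q 1 1 1 T) : T = familyTriple (s ^ 2) := by
  have rv := h.tripleSolution_rev hT
  have z0 := hT.zero_fst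
  have z1 := hT.zero_snd
  have z2 := hT.zero_trd
  -- Reversal exchanges 0 with 5 and 1 with 4, so the known values at index 0 determine those at
  -- index 5.
  have w0 : ∀ j k, T 5 j k = if j = 4 ∧ k = 4 then 1 else 0 := by
    intro j k
    rw [← rv 5 j k, show (5 : Fin 6).rev = 0 from rfl, z0]
    simp only [Fin.rev_eq_iff, show (1 : Fin 6).rev = 4 from rfl]
  have w1 : ∀ i k, T i 5 k = if i = 4 ∧ k = 4 then 1 else 0 := by
    intro i k
    rw [← rv i 5 k, show (5 : Fin 6).rev = 0 from rfl, z1]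
    simp only [Fin.rev_eq_iff, show (1 : Fin 6).rev = 4 from rfl]
  have w2 : ∀ i j, T i j 5 = if i = 4 ∧ j = 4 then 1 else 0 := by
    intro i j
    rw [← rv i j 5, show (5 : Fin 6).rev = 0 from rfl, z2]
    simp only [Fin.rev_eq_iff, show (1 : Fin 6).rev = 4 from rfl]
  have sf : ∀ j k, ∑ l, T l j k = familyP (s ^ 2) j k := fun j k =>
    (hT.sum_fst j k).trans (h.p_one_eq_familyP hs j k)
  have ss : ∀ i k, ∑ l, T i l k = familyP (s ^ 2) i k := fun i k =>
    (hT.sum_snd i k).trans (h.p_one_eq_familyP hs i k)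
  have st : ∀ i j, ∑ l, T i j l = familyP (s ^ 2) i j := fun i j =>
    (hT.sum_trd i j).trans (h.p_one_eq_familyP hs i j)
  -- Nonnegativity enters here: a line of entries with sum p_{jk}^1 = 0 vanishes termwise.
  have nf : ∀ j k, familyP (s ^ 2) j k = 0 → ∀ l, T l j k = 0 := fun j k h0 l =>
    (Finset.sum_eq_zero_iff_of_nonneg fun l _ => hT.nonneg l j k).1 ((sf j k).trans h0) l
      (Finset.mem_univ l)
  have ns : ∀ i k, familyP (s ^ 2) i k = 0 → ∀ l, T i l k = 0 := fun i k h0 l =>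
    (Finset.sum_eq_zero_iff_of_nonneg fun l _ => hT.nonneg i l k).1 ((ss i k).trans h0) l
      (Finset.mem_univ l)
  have nt : ∀ i j, familyP (s ^ 2) i j = 0 → ∀ l, T i j l = 0 := fun i j h0 l =>
    (Finset.sum_eq_zero_iff_of_nonneg fun l _ => hT.nonneg i j l).1 ((st i j).trans h0) l
      (Finset.mem_univ l)
  have p13 : familyP (s ^ 2) 1 3 = 0 := rfl
  have p31 : familyP (s ^ 2) 3 1 = 0 := rfl
  have p24 : familyP (s ^ 2) 2 4 = 0 := rfl
  have p42 : familyP (s ^ 2) 4 2 = 0 := rfl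
  have f13 := nf 1 3 p13
  have f31 := nf 3 1 p31
  have f24 := nf 2 4 p24
  have f42 := nf 4 2 p42
  have s13 := ns 1 3 p13
  have s31 := ns 3 1 p31
  have s24 := ns 2 4 p24
  have s42 := ns 4 2 p42
  have t13 := nt 1 3 p13
  have t31 := nt 3 1 p31
  have t24 := nt 2 4 p24
  have t42 := nt 4 2 p42
  have p11 : familyP (s ^ 2) 1 1 = (s ^ 2 - 1) / 2 := rfl
  have p12 : familyP (s ^ 2) 1 2 = (s ^ 2) ^ 2 := rfl
  have p14 : familyP (s ^ 2) 1 4 = (s ^ 2 - 1) / 2 := rfl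
  have p21 : familyP (s ^ 2) 2 1 = (s ^ 2) ^ 2 := rfl
  have p22 : familyP (s ^ 2) 2 2 = (s ^ 2) ^ 2 * (s ^ 2 - 1) / 2 := rfl
  have p23 : familyP (s ^ 2) 2 3 = (s ^ 2) ^ 2 * (s ^ 2 - 1) / 2 := rfl
  -- Up to reversal, fourteen entries with indices in 1, …, 4 remain undetermined.
  have r111 : T 4 4 4 = T 1 1 1 := rv 1 1 1
  have r112 : T 4 4 3 = T 1 1 2 := rv 1 1 2
  have r121 : T 4 3 4 = T 1 2 1 := rv 1 2 1
  have r211 : T 3 4 4 = T 2 1 1 := rv 2 1 1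
  have r122 : T 4 3 3 = T 1 2 2 := rv 1 2 2
  have r212 : T 3 4 3 = T 2 1 2 := rv 2 1 2
  have r221 : T 3 3 4 = T 2 2 1 := rv 2 2 1
  have r222 : T 3 3 3 = T 2 2 2 := rv 2 2 2
  have r114 : T 4 4 1 = T 1 1 4 := rv 1 1 4
  have r141 : T 4 1 4 = T 1 4 1 := rv 1 4 1
  have r411 : T 1 4 4 = T 4 1 1 := rv 4 1 1
  have r223 : T 3 3 2 = T 2 2 3 := rv 2 2 3
  have r232 : T 3 2 3 = T 2 3 2 := rv 2 3 2
  have r322 : T 2 3 3 = T 3 2 2 := rv 3 2 2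
  have ef11 := sf 1 1
  have ef12 := sf 1 2
  have ef14 := sf 1 4
  have ef21 := sf 2 1
  have ef22 := sf 2 2
  have ef23 := sf 2 3
  have es11 := ss 1 1
  have es12 := ss 1 2
  have es14 := ss 1 4
  have es23 := ss 2 3
  have et11 := st 1 1
  have et12 := st 1 2
  have et14 := st 1 4
  have et23 := st 2 3
  simp [Fin.sum_univ_six, z0, z1, z2, w0, w1, w2, f13, f31, f24, f42, s13, s31, s24, s42, t13,
    t31, t24, t42, r411, r322, p11, p12, p14, p21, p22, p23]
    at ef11 ef12 ef14 ef21 ef22 ef23 es11 es12 es14 es23 et11 et12 et14 et23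
  -- The pairwise sums of T_{114}, T_{141}, T_{411} all equal p_{14}^1, so each is half of it;
  -- likewise for the 223 family with p_{23}^1.
  have v114 : T 1 1 4 = (s ^ 2 - 1) / 4 := by linarith
  have v141 : T 1 4 1 = (s ^ 2 - 1) / 4 := by linarith
  have v411 : T 4 1 1 = (s ^ 2 - 1) / 4 := by linarith
  have v223 : T 2 2 3 = (s ^ 2) ^ 2 * (s ^ 2 - 1) / 4 := by linarith
  have v232 : T 2 3 2 = (s ^ 2) ^ 2 * (s ^ 2 - 1) / 4 := by linarith
  have v322 : T 3 2 2 = (s ^ 2) ^ 2 * (s ^ 2 - 1) / 4 := by linarith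
  -- The other entries depend on the single parameter T_{112}.
  have v121 : T 1 2 1 = T 1 1 2 := by linarith
  have v211 : T 2 1 1 = T 1 1 2 := by linarith
  have v111 : T 1 1 1 = (s ^ 2 - 5) / 4 - T 1 1 2 := by linarith
  have v122 : T 1 2 2 = (s ^ 2) ^ 2 - T 1 1 2 := by linarith
  have v212 : T 2 1 2 = (s ^ 2) ^ 2 - T 1 1 2 := by linarith
  have v221 : T 2 2 1 = (s ^ 2) ^ 2 - T 1 1 2 := by linarith
  have v222 : T 2 2 2 = (s ^ 2) ^ 2 * (s ^ 2 - 5) / 4 + T 1 1 2 := by linarith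
  -- The index sum is even, so this equation is independent of the reversal symmetry. It reduces to
  -- a nonzero multiple of T_{112}, where s > 1 keeps the factor (s - 1)^2 away from zero.
  have kr := hT.krein 1 1 4 (h.krein_one_eq_zero_of_lt (by decide))
  simp only [Nat.reduceAdd, Fin.sum_univ_six] at kr
  simp [z0, z1, z2, w0, w1, w2, f13, f31, f24, f42, s13, s31, s24, s42,
    t13, t31, t24, t42, r111, r112, r121, r211, r122, r212, r221, r222, r114, r141, r411, r223,
    r232, r322, v114, v141, v411, v223, v232, v322, v121, v211, v111, v122, v212, v221,
    v222] at kr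
  have v112 : T 1 1 2 = 0 := by
    have hs0 : s ≠ 0 := by positivity
    have hs1 : s - 1 ≠ 0 := sub_ne_zero.2 hs.ne'
    simp [familyQ] at kr
    field_simp at kr
    have hn : (s ^ 4 + 1) ^ 3 * (s - 1) ^ 2 * (s ^ 2 + 1) ≠ 0 := by positivity
    refine (mul_eq_zero.1 ?_).resolve_left hn
    linear_combination (1 / 8) * kr
  rw [v112] at v121 v211 v111 v122 v212 v221 v222
  refine funext (forall_fin_six ?_ ?_ ?_ ?_ ?_ ?_) <;>
    refine funext (forall_fin_six ?_ ?_ ?_ ?_ ?_ ?_) <;>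
    refine funext (forall_fin_six ?_ ?_ ?_ ?_ ?_ ?_) <;>
    simp [familyTriple, z0, z1, z2, w0, w1, w2, f13, f31, f24, f42, s13, s31, s24, s42,
      t13, t31, t24, t42, r111, r112, r121, r211, r122, r212, r221, r222, r114, r141, r411, r223,
      r232, r322, v114, v141, v411, v223, v232, v322, v112, v121, v211, v111, v122, v212, v221,
      v222]

end TripleSolution

end AssociationScheme

/-! ### Uniqueness, the triangle count and the congruence obstruction. -/

theorem mainTheorem5 {X : Type*} [Fintype X] [DecidableEq X] (r : ℕ) :
    (r % 4 = 3 →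
      ¬ ∃ S : AssociationScheme X 5, S.HasKreinArray (familyB r) (familyC r)) ∧
    (Odd r → 3 ≤ r → ∀ (S : AssociationScheme X 5) (E : Fin 6 → Matrix X X ℝ)
      (Q : Matrix (Fin 6) (Fin 6) ℝ) (q : Fin 6 → Fin 6 → Fin 6 → ℝ),
      S.IsQPolynomialWithKreinArray E Q q (familyB r) (familyC r) →
      AssociationScheme.IsNaturalOrdering Q →
      ∀ x y z : X, S.rel x y = 1 → S.rel x z = 1 → S.rel y z = 1 →
        (∀ T : Fin 6 → Fin 6 → Fin 6 → ℝ, S.IsTripleSolution Q q 1 1 1 T ↔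
          T = fun i j k => (S.triple x y z i j k : ℝ)) ∧
        (S.triple x y z 1 1 1 : ℝ) = ((r : ℝ) - 5) / 4) ∧
    ((∃ n : ℤ, (n : ℝ) = ((r : ℝ) - 5) / 4) ↔ r % 4 = 1) := by
  have hsq : (r : ℝ) = √r ^ 2 := (Real.sq_sqrt (Nat.cast_nonneg r)).symm
  have hs : 3 ≤ r → 1 < √(r : ℝ) := fun h3 => by
    rw [Real.lt_sqrt zero_le_one]
    have : (3 : ℝ) ≤ r := by exact_mod_cast h3
    linarith
  have key : 3 ≤ r → ∀ (S : AssociationScheme X 5) (E : Fin 6 → Matrix X X ℝ)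
      (Q : Matrix (Fin 6) (Fin 6) ℝ) (q : Fin 6 → Fin 6 → Fin 6 → ℝ),
      S.IsQPolynomialWithKreinArray E Q q (familyB r) (familyC r) →
      AssociationScheme.IsNaturalOrdering Q →
      (S.p 1 1 1 : ℝ) = ((r : ℝ) - 1) / 2 ∧
      ∀ x y z : X, S.rel x y = 1 → S.rel x z = 1 → S.rel y z = 1 →
        (∀ T : Fin 6 → Fin 6 → Fin 6 → ℝ, S.IsTripleSolution Q q 1 1 1 T ↔
          T = fun i j k => (S.triple x y z i j k : ℝ)) ∧
        (S.triple x y z 1 1 1 : ℝ) = ((r : ℝ) - 5) / 4 := by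
    intro h3 S E Q q h hQ
    rw [hsq] at h
    obtain rfl := h.eq_familyQ (hs h3) hQ
    refine ⟨?_, fun x y z hxy hxz hyz => ?_⟩
    · rw [h.p_one_eq_familyP (hs h3) 1 1, ← hsq]
      rfl
    have h1 := h.isTripleSolution x y z
    rw [hxy, hxz, hyz] at h1
    have h2 := h.tripleSolution_eq (hs h3) h1
    refine ⟨fun T => ⟨fun hT => (h.tripleSolution_eq (hs h3) hT).trans h2.symm, ?_⟩, ?_⟩
    · rintro rfl
      exact h1
    · have h4 := congrFun (congrFun (congrFun h2 1) 1) 1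
      rw [← hsq] at h4
      exact h4
  refine ⟨?_, fun _ h3 S E Q q h hQ => (key h3 S E Q q h hQ).2, ?_⟩
  · rintro hr ⟨S, h⟩
    have h3 : 3 ≤ r := by omega
    rw [hsq] at h
    obtain ⟨S, E, Q, q, h, hQ⟩ := h.exists_isNaturalOrdering (hs h3)
    rw [← hsq] at h
    obtain ⟨hp, htriple⟩ := key h3 S E Q q h hQ
    obtain ⟨x, y, hxy⟩ := S.rel_nonempty 1
    -- A positive p_{11}^1 extends an edge of R_1 to a triangle, without which the count [1 1 1]
    -- would say nothing.
    have hpos : 0 < S.p 1 1 1 := by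
      have : (3 : ℝ) ≤ r := by exact_mod_cast h3
      rw [← Nat.cast_pos (α := ℝ), hp]
      linarith
    rw [← S.card_eq_p 1 1 1 x y hxy, Finset.card_pos] at hpos
    obtain ⟨z, hz⟩ := hpos
    rw [Finset.mem_filter] at hz
    have h5 := (htriple x y z hxy hz.2.1 hz.2.2).2
    have h6 : 4 * S.triple x y z 1 1 1 + 5 = r := by
      have h7 : 4 * (S.triple x y z 1 1 1 : ℝ) + 5 = r := by linarith
      exact_mod_cast h7
    omega
  · constructor
    · rintro ⟨n, hn⟩
      have h1 : 4 * (n : ℝ) + 5 = r := by linarith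
      have h2 : 4 * n + 5 = (r : ℤ) := by exact_mod_cast h1
      omega
    · intro hr
      -- The subtraction is in ℤ because r = 1 gives -1; the division is exact since r ≡ 1 (mod 4).
      refine ⟨((r : ℤ) - 5) / 4, ?_⟩
      have h1 : 4 * (((r : ℤ) - 5) / 4) + 5 = r := by omega
      have h2 : 4 * ((((r : ℤ) - 5) / 4 : ℤ) : ℝ) + 5 = r := by exact_mod_cast h1
      linarith
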